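/- Let $\alpha\in(0,1)$ and consider $n$ null hypotheses with p-values $p=(p_1,\dots,p_n)\in[0,1]^n$, where $I_0\subseteq\{1,\dots,n\}$ is the set of true nulls, $n_0=|I_0|\ge 1$, and $I_1$ is its complement. The basic independence model at sample size $n$, $\mathcal P_{BI(n)}$, consists of all distributions of $p$ (with any such $I_0$) for which the vectors $(p_i)_{i\in I_0}$ and $(p_i)_{i\in I_1}$ are independent, the $(p_i)_{i\in I_0}$ are mutually independent, and $P(p_i\le x)\le x$ for all $x\in[0,1]$ and $i\in I_0$; the dependence within $(p_i)_{i\in I_1}$ is arbitrary. For $0\le\delta<1-\alpha$ the step-up test with critical values $$a_i=a_i(\delta)=\frac{i\alpha}{n+1-i\delta},\qquad 1\le i\le n,$$ rejects all hypotheses with $p_i\le\tau$, where $\tau=\max\{a_i: p_{i:n}\le a_i\}$ ($\max\emptyset=0$) and $p_{1:n}\le\dots\le p_{n:n}$ are the ordered p-values. Its false discovery rate is $\mathrm{FDR}(n,\delta)=\mathbb E\left[V/R\right]$ with $0/0=0$, where $R=|\{i: p_i\le\tau\}|$ and $V=|\{i\in I_0: p_i\le\tau\}|$. Let $(\delta_n)_{n\ge1}$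 be a sequence with $0\le\delta_n<1-\alpha$. (a) If $\limsup_{n\to\infty}\delta_n<1-\alpha$, then $$\limsup_{n\to\infty}\ \sup_{\mathcal P_{BI(n)}}\mathrm{FDR}(n,\delta_n)=\alpha.$$ (b) If $\delta_n\to\delta\in(0,1-\alpha)$ and $\alpha<c<1$, then $$\limsup_{n\to\infty}\ \sup_{\mathcal P_{BI(n)},\ n_0\le cn}\mathrm{FDR}(n,\delta_n)=\frac{c\,x(\delta)}{1-c+c\,x(\delta)}<\alpha,$$ where $$x(\delta)=\frac{1-c\alpha-\delta(1-c)-\left((c\alpha+\delta(1-c)-1)^2-4(1-c)c\alpha\delta\right)^{1/2}}{2c\delta}.$$ -/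

import Mathlib

open MeasureTheory ProbabilityTheory Filter Topology

namespace StepUp

/-- The order statistic `p_{i:n}`; the index `i : Fin n` stands for the `(i + 1)`-th smallest
of the p-values. -/
noncomputable def orderStat {n : ℕ} (p : Fin n → ℝ) (i : Fin n) : ℝ :=
  p (Tuple.sort p i)

/-- The step-up critical boundary variable `τ_SU = max {a_i : p_{i:n} ≤ a_i}` with `max ∅ = 0`
(the supremum is over a finite set, and `sSup ∅ = 0` for real numbers). -/
noncomputable def tauSU {n : ℕ} (a : Fin n → ℝ) (p : Fin n → ℝ) : ℝ :=
  sSup {t : ℝ | ∃ i : Fin n, orderStat p i ≤ a i ∧ t = a i}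

/-- The number `V(t)` of true null hypotheses (those in `I₀`) with p-value at most `t`. -/
noncomputable def numFalseRej {n : ℕ} (I₀ : Finset (Fin n)) (p : Fin n → ℝ) (t : ℝ) : ℕ :=
  (I₀.filter (fun i => p i ≤ t)).card

/-- The number `R(t)` of all hypotheses with p-value at most `t`. -/
noncomputable def numRej {n : ℕ} (p : Fin n → ℝ) (t : ℝ) : ℕ :=
  (Finset.univ.filter (fun i => p i ≤ t)).card

/-- The false discovery rate `E[V(τ)/R(τ)]`, with `0/0 = 0`, of the step-up test with critical
values `a`, when `I₀` is the set of true nulls and `P` is the distribution of the p-values. -/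
noncomputable def fdrSU {n : ℕ} (a : Fin n → ℝ) (I₀ : Finset (Fin n))
    (P : Measure (Fin n → ℝ)) : ℝ :=
  ∫ p, (numFalseRej I₀ p (tauSU a p) : ℝ) / (numRej p (tauSU a p) : ℝ) ∂P

/-- The basic independence model: `P` is the distribution of a vector of p-values in `[0,1]^n`
with set of true nulls `I₀`. The true p-values are independent of each other, jointly independent
of the vector of false p-values, and stochastically larger than the uniform distribution; the
dependence among the false p-values is arbitrary. -/
structure IsBIA {n : ℕ} (I₀ : Finset (Fin n)) (P : Measure (Fin n → ℝ)) : Prop where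
  isProb : IsProbabilityMeasure P
  mem_Icc : ∀ᵐ p ∂P, ∀ i, p i ∈ Set.Icc (0 : ℝ) 1
  indep_groups : IndepFun (fun (p : Fin n → ℝ) (i : {i // i ∈ I₀}) => p i)
    (fun (p : Fin n → ℝ) (i : {i // i ∉ I₀}) => p i) P
  indep_true : iIndepFun (fun (i : {i // i ∈ I₀}) (p : Fin n → ℝ) => p i) P
  superuniform : ∀ i ∈ I₀, ∀ x ∈ Set.Icc (0 : ℝ) 1, P.real {p | p i ≤ x} ≤ x

/-- The critical values `a_i = iα/(n+1-iδ)` for `i = 1, …, n` (stored at the index `i - 1`). -/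
noncomputable def critVal (α δ : ℝ) (n : ℕ) (i : Fin n) : ℝ :=
  ((i : ℝ) + 1) * α / ((n : ℝ) + 1 - ((i : ℝ) + 1) * δ)

/-- The worst-case FDR at sample size `n` over all distributions of the basic independence model
with at least one true null. -/
noncomputable def worstFDR (α δ : ℝ) (n : ℕ) : ℝ :=
  sSup {r : ℝ | ∃ (I₀ : Finset (Fin n)) (P : Measure (Fin n → ℝ)),
    I₀.Nonempty ∧ IsBIA I₀ P ∧ r = fdrSU (critVal α δ n) I₀ P}

/-- The worst-case FDR at sample size `n` over all distributions of the basic independence model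
whose number `n₀ ≥ 1` of true nulls satisfies `n₀ ≤ c n`. -/
noncomputable def worstFDRBounded (α δ c : ℝ) (n : ℕ) : ℝ :=
  sSup {r : ℝ | ∃ (I₀ : Finset (Fin n)) (P : Measure (Fin n → ℝ)),
    I₀.Nonempty ∧ (I₀.card : ℝ) ≤ c * n ∧ IsBIA I₀ P ∧ r = fdrSU (critVal α δ n) I₀ P}

/-- The number `x(δ)`: the root in `(0,1)` of `x / (δ x + α) = (1 - c) + c x`. -/
noncomputable def xRoot (α c δ : ℝ) : ℝ :=
  (1 - c * α - δ * (1 - c)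
    - Real.sqrt ((c * α + δ * (1 - c) - 1) ^ 2 - 4 * (1 - c) * c * α * δ)) / (2 * c * δ)

end StepUp

/-! The critical values are built so that `R (α + δ τ) = (n + 1) τ` at the threshold `τ`. Hence `V /
R = (α V / τ + δ V) / (n + 1)`, and the FDR splits into two expectations (`fdrSU_eq`).

The term `V / τ` is handled by leaving one out. Zeroing a rejected p-value does not move the
threshold, and the zeroed threshold is independent of a true `p i`. Conditioning on its value shows
that each true null contributes at most 1 to `E[V / τ]`, with equality for uniform nulls. So the FDR
is at most `(α n₀ + δ E[V]) / (n + 1)`.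

For the upper bound, Chebyshev on a finite grid and monotonicity give `V(t) ≤ n₀ t + O(ε n)` for all
`t` in `[0,1]` at once, off an event of small probability. With `R ≤ V + n - n₀` this confines `τ`,
and the real inequality `threshold_bound` turns the confinement into the limit `L = c (α + d x)`,
where `x` is the smaller root of `(α + d y)(1 - c + c y) = y`. Part (a) is the degenerate case `x =
0`, `L = α`, with proportion bound 1.

For the lower bound, true nulls are uniform and false p-values are zero. In (a) all hypotheses are
true and the FDR is at least `α n / (n + 1)`. In (b), with `w = E[V]`, the FDR `F` equals `(α n₀ + δ
w) / (n + 1)`, while concavity of `v / (v + n - n₀)` gives `F ≤ w / (w + n - n₀)`. These two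
relations alone keep `w / n₀` from falling appreciably below `x`, hence `F` from falling below `L`,
so no concentration is needed here. -/

namespace StepUp

/-! ### Pathwise properties of the step-up threshold. -/

section Deterministic

variable {n : ℕ} {a p q : Fin n → ℝ}

lemma numRej_mono (p : Fin n → ℝ) : Monotone (numRej p) := fun _ _ hst =>
  Finset.card_le_card (Finset.monotone_filter_right _ fun _ _ h => h.trans hst)

lemma numRej_le (p : Fin n → ℝ) (t : ℝ) : numRej p t ≤ n := by
  unfold numRej
  simpa using (Finset.card_filter_le (Finset.univ : Finset (Fin n)) fun i => p i ≤ t)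

lemma numFalseRej_mono (I₀ : Finset (Fin n)) (p : Fin n → ℝ) : Monotone (numFalseRej I₀ p) :=
  fun _ _ hst => Finset.card_le_card (Finset.monotone_filter_right _ fun _ _ h => h.trans hst)

lemma numFalseRej_le_card (I₀ : Finset (Fin n)) (p : Fin n → ℝ) (t : ℝ) :
    numFalseRej I₀ p t ≤ I₀.card := Finset.card_filter_le _ _

lemma numFalseRej_le_numRej (I₀ : Finset (Fin n)) (p : Fin n → ℝ) (t : ℝ) :
    numFalseRej I₀ p t ≤ numRej p t :=
  Finset.card_le_card (Finset.filter_subset_filter _ (Finset.subset_univ _))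

lemma numRej_eq_add (I₀ : Finset (Fin n)) (p : Fin n → ℝ) (t : ℝ) :
    numRej p t = numFalseRej I₀ p t + (I₀ᶜ.filter fun i => p i ≤ t).card := by
  unfold numRej numFalseRej
  rw [← Finset.card_union_of_disjoint
    (Finset.disjoint_filter_filter disjoint_compl_right), ← Finset.filter_union,
    Finset.union_compl]

lemma numRej_le_add (I₀ : Finset (Fin n)) (p : Fin n → ℝ) (t : ℝ) :
    (numRej p t : ℝ) ≤ numFalseRej I₀ p t + (n - I₀.card) := by
  have h1 := numRej_eq_add I₀ p t
  have h2 : (I₀ᶜ.filter fun i => p i ≤ t).card ≤ I₀ᶜ.card := Finset.card_filter_le _ _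
  have h3 : I₀.card + I₀ᶜ.card = n := by simp
  have h4 : numRej p t + I₀.card ≤ numFalseRej I₀ p t + n := by omega
  have : (numRej p t : ℝ) + I₀.card ≤ numFalseRej I₀ p t + n := by exact_mod_cast h4
  linarith

lemma orderStat_le_iff (p : Fin n → ℝ) (k : Fin n) (t : ℝ) :
    orderStat p k ≤ t ↔ (k : ℕ) < numRej p t := by
  have h := Tuple.lt_card_le_iff_apply_le_of_monotone (f := p ∘ Tuple.sort p) (j := k) (a := t)
    (Tuple.monotone_sort p)
  have hc : (Finset.univ.filter fun i => (p ∘ Tuple.sort p) i ≤ t).card = numRej p t := by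
    unfold numRej
    exact Finset.card_bij (fun i _ => Tuple.sort p i) (by simp)
      (fun _ _ _ _ h => (Tuple.sort p).injective h)
      (fun b hb => ⟨(Tuple.sort p).symm b, by simpa using hb, by simp⟩)
  rw [hc] at h
  exact h.symm

lemma tauSU_eq (a p : Fin n → ℝ) :
    tauSU a p = sSup (a '' {k | (k : ℕ) < numRej p (a k)}) := by
  unfold tauSU
  congr 1
  ext t
  simp only [orderStat_le_iff, Set.mem_ofPred_eq, Set.mem_image]
  exact exists_congr fun i => and_congr_right fun _ => eq_comm

lemma le_tauSU {k : Fin n} (hk : (k : ℕ) < numRej p (a k)) : a k ≤ tauSU a p := by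
  rw [tauSU_eq]
  exact le_csSup (Set.toFinite _).bddAbove ⟨k, hk, rfl⟩

lemma tauSU_cases (a p : Fin n → ℝ) :
    (tauSU a p = 0 ∧ ∀ k : Fin n, ¬ (k : ℕ) < numRej p (a k)) ∨
      ∃ k : Fin n, tauSU a p = a k ∧ (k : ℕ) < numRej p (a k) := by
  rcases Set.eq_empty_or_nonempty {k : Fin n | (k : ℕ) < numRej p (a k)} with h | h
  · left
    refine ⟨by rw [tauSU_eq, h]; simp, fun k hk => ?_⟩
    exact (h ▸ hk : k ∈ (∅ : Set (Fin n)))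
  · right
    obtain ⟨k, hk, hk'⟩ := (h.image a).csSup_mem (Set.toFinite _)
    exact ⟨k, by rw [tauSU_eq, hk'], hk⟩

lemma tauSU_nonneg (ha : ∀ k, 0 < a k) : 0 ≤ tauSU a p := by
  rcases tauSU_cases a p with h | ⟨k, h, -⟩
  · exact h.1.ge
  · exact h ▸ (ha k).le

/-- Either nothing is rejected, or the threshold is the critical value whose rank is the number
of rejections. -/
lemma tauSU_spec (hmono : StrictMono a) (ha : ∀ k, 0 < a k) (p : Fin n → ℝ) :
    (tauSU a p = 0 ∧ numRej p (tauSU a p) = 0) ∨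
      ∃ k : Fin n, tauSU a p = a k ∧ numRej p (tauSU a p) = k + 1 := by
  rcases tauSU_cases a p with ⟨h0, h⟩ | ⟨k, hk, hlt⟩
  · refine Or.inl ⟨h0, ?_⟩
    by_contra hne
    have hn : 0 < n := lt_of_lt_of_le (Nat.pos_of_ne_zero hne) (numRej_le p _)
    exact h ⟨0, hn⟩ (lt_of_lt_of_le (Nat.pos_of_ne_zero hne)
      (numRej_mono p (h0 ▸ (ha ⟨0, hn⟩).le)))
  · refine Or.inr ⟨k, hk, ?_⟩
    rw [hk]
    -- With more than `k + 1` p-values below `a k`, index `k + 1` would be admissible too, giving a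
    -- larger threshold.
    by_contra hne
    have h1 : (k : ℕ) + 1 < numRej p (a k) := by omega
    have hn := h1.trans_le (numRej_le p _)
    have hkj : k < ⟨k + 1, hn⟩ := by simp [Fin.lt_def]
    have := le_tauSU (a := a) (p := p) (k := ⟨k + 1, hn⟩)
      (h1.trans_le (numRej_mono p (hmono hkj).le))
    rw [hk] at this
    exact absurd (hmono hkj) this.not_gt

lemma numRej_le_numRej {s t : ℝ} (h : ∀ i, p i ≤ s → q i ≤ t) : numRej p s ≤ numRej q t :=
  Finset.card_le_card (Finset.monotone_filter_right _ fun i _ => h i)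

lemma tauSU_le_tauSU (ha : ∀ k, 0 < a k) (h : ∀ k i, p i ≤ a k → q i ≤ a k) :
    tauSU a p ≤ tauSU a q := by
  rcases tauSU_cases a p with h0 | ⟨k, hk, hlt⟩
  · exact h0.1 ▸ tauSU_nonneg ha
  · exact hk ▸ le_tauSU (hlt.trans_le (numRej_le_numRej (h k)))

/-- A zero p-value lies below every critical value, so the smallest index is always admissible. -/
lemma tauSU_update_pos (ha : ∀ k, 0 < a k) (p : Fin n → ℝ) (i : Fin n) :
    ∃ k, tauSU a (Function.update p i 0) = a k := by
  rcases tauSU_cases a (Function.update p i 0) with ⟨-, h⟩ | ⟨k, hk, -⟩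
  · have hn : 0 < n := i.pos
    refine absurd ?_ (h ⟨0, hn⟩)
    exact Finset.card_pos.2 ⟨i, by simpa using (ha _).le⟩
  · exact ⟨k, hk⟩

lemma tauSU_le_update (ha : ∀ k, 0 < a k) (p : Fin n → ℝ) (i : Fin n) :
    tauSU a p ≤ tauSU a (Function.update p i 0) := by
  refine tauSU_le_tauSU ha fun k j hj => ?_
  rcases eq_or_ne j i with rfl | hne
  · simpa using (ha k).le
  · simpa [hne] using hj

/-- Setting a rejected p-value to zero does not change the threshold. -/
lemma tauSU_update_eq (ha : ∀ k, 0 < a k) {i : Fin n}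
    (hi : p i ≤ tauSU a (Function.update p i 0)) :
    tauSU a (Function.update p i 0) = tauSU a p := by
  refine le_antisymm ?_ (tauSU_le_update ha p i)
  rcases tauSU_cases a (Function.update p i 0) with ⟨h, -⟩ | ⟨k, hk, hlt⟩
  · rw [h]
    exact tauSU_nonneg ha
  · rw [hk] at hi ⊢
    -- Since `p i ≤ a k`, coordinate `i` is counted at level `a k` with or without zeroing, so `k`
    -- is admissible for `p` as well.
    refine le_tauSU (hlt.trans_le (numRej_le_numRej fun j hj => ?_))
    rcases eq_or_ne j i with rfl | hne
    · exact hi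
    · simpa [hne] using hj

lemma le_tauSU_update_iff (ha : ∀ k, 0 < a k) {i : Fin n} :
    p i ≤ tauSU a (Function.update p i 0) ↔ p i ≤ tauSU a p :=
  ⟨fun h => tauSU_update_eq ha h ▸ h, fun h => h.trans (tauSU_le_update ha p i)⟩

/-- The zeroed threshold does not involve `p i`. Splitting over its values turns the left side into
events that factor under independence; only one summand can be nonzero because `a` is injective. -/
lemma indicator_div_tauSU_eq_sum (hmono : StrictMono a) (ha : ∀ k, 0 < a k) (p : Fin n → ℝ)
    (i : Fin n) :
    (if p i ≤ tauSU a p then (tauSU a p)⁻¹ else 0) =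
      ∑ k, if p i ≤ a k ∧ tauSU a (Function.update p i 0) = a k then (a k)⁻¹ else 0 := by
  obtain ⟨k, hk⟩ := tauSU_update_pos ha p i
  rw [Finset.sum_eq_single k]
  · by_cases h : p i ≤ a k
    · have h' : p i ≤ tauSU a (Function.update p i 0) := hk ▸ h
      rw [if_pos ((le_tauSU_update_iff ha).1 h'), if_pos ⟨h, hk⟩, ← tauSU_update_eq ha h', hk]
    · rw [if_neg, if_neg (fun h' => h h'.1)]
      rw [← le_tauSU_update_iff ha, hk]
      exact h
  · intro j _ hj
    rw [if_neg]
    rintro ⟨-, h⟩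
    exact hj (hmono.injective (h.symm.trans hk))
  · simp

lemma numFalseRej_eq_sum (I₀ : Finset (Fin n)) (p : Fin n → ℝ) (t : ℝ) :
    (numFalseRej I₀ p t : ℝ) = ∑ i ∈ I₀, if p i ≤ t then (1 : ℝ) else 0 := by
  simp [numFalseRej]

end Deterministic

/-! ### The critical values and the identity for the false discovery proportion. -/

section CritVal

variable {n : ℕ} {α δ : ℝ}

lemma critVal_denom_pos (hα : 0 < α) (hδ : 0 ≤ δ) (hδ' : δ < 1 - α) (k : Fin n) :
    0 < (n : ℝ) + 1 - ((k : ℝ) + 1) * δ := by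
  have hk : (k : ℝ) + 1 ≤ n := by exact_mod_cast k.2
  have : ((k : ℝ) + 1) * δ ≤ n * 1 := mul_le_mul hk (by linarith) hδ (by positivity)
  linarith

lemma critVal_pos (hα : 0 < α) (hδ : 0 ≤ δ) (hδ' : δ < 1 - α) (k : Fin n) :
    0 < critVal α δ n k :=
  div_pos (by positivity) (critVal_denom_pos hα hδ hδ' k)

lemma critVal_strictMono (hα : 0 < α) (hδ : 0 ≤ δ) (hδ' : δ < 1 - α) :
    StrictMono (critVal α δ n) := by
  intro j k hjk
  have hjk' : (j : ℝ) + 1 < k + 1 := by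
    have : (j : ℝ) < k := by exact_mod_cast hjk
    linarith
  refine div_lt_div₀ (mul_lt_mul_of_pos_right hjk' hα) ?_ (by positivity)
    (critVal_denom_pos hα hδ hδ' k)
  nlinarith

lemma critVal_le_one (hα : 0 < α) (hδ : 0 ≤ δ) (hδ' : δ < 1 - α) (k : Fin n) :
    critVal α δ n k ≤ 1 := by
  unfold critVal
  rw [div_le_one (critVal_denom_pos hα hδ hδ' k)]
  have hk : (k : ℝ) + 1 ≤ n := by exact_mod_cast k.2
  nlinarith

lemma tauSU_critVal_le_one (hα : 0 < α) (hδ : 0 ≤ δ) (hδ' : δ < 1 - α) (p : Fin n → ℝ) :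
    tauSU (critVal α δ n) p ≤ 1 := by
  rcases tauSU_cases (critVal α δ n) p with h | ⟨k, hk, -⟩
  · rw [h.1]; exact zero_le_one
  · exact hk ▸ critVal_le_one hα hδ hδ' k

/-- The number of rejections `R` satisfies `R (α + δ τ) = (n + 1) τ`. -/
lemma numRej_mul_eq (hα : 0 < α) (hδ : 0 ≤ δ) (hδ' : δ < 1 - α) (p : Fin n → ℝ) :
    (numRej p (tauSU (critVal α δ n) p) : ℝ) * (α + δ * tauSU (critVal α δ n) p) =
      (n + 1) * tauSU (critVal α δ n) p := by
  rcases tauSU_spec (critVal_strictMono hα hδ hδ') (critVal_pos hα hδ hδ') p with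
    ⟨h0, h⟩ | ⟨k, hk, h⟩
  · rw [h, h0]; simp
  · rw [h, hk]
    have := critVal_denom_pos hα hδ hδ' k
    unfold critVal
    push_cast
    field_simp
    ring

/-- The false discovery proportion of the step-up test in terms of `V / τ` and `V`. -/
lemma fdp_eq (hα : 0 < α) (hδ : 0 ≤ δ) (hδ' : δ < 1 - α) (I₀ : Finset (Fin n))
    (p : Fin n → ℝ) :
    (numFalseRej I₀ p (tauSU (critVal α δ n) p) : ℝ) / numRej p (tauSU (critVal α δ n) p) =
      (α * (∑ i ∈ I₀, if p i ≤ tauSU (critVal α δ n) p then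
        (tauSU (critVal α δ n) p)⁻¹ else 0) +
        δ * numFalseRej I₀ p (tauSU (critVal α δ n) p)) / (n + 1) := by
  have hm := numRej_mul_eq hα hδ hδ' p
  have hs : (∑ i ∈ I₀, if p i ≤ tauSU (critVal α δ n) p then
        (tauSU (critVal α δ n) p)⁻¹ else 0) =
      numFalseRej I₀ p (tauSU (critVal α δ n) p) * (tauSU (critVal α δ n) p)⁻¹ := by
    rw [numFalseRej_eq_sum, Finset.sum_mul]
    exact Finset.sum_congr rfl fun i _ => by simp
  rw [hs]
  have hV := numFalseRej_le_numRej I₀ p (tauSU (critVal α δ n) p)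
  rcases tauSU_spec (critVal_strictMono hα hδ hδ') (critVal_pos hα hδ hδ') p with
    ⟨h0, h⟩ | ⟨k, hk, h⟩
  -- With no rejections the convention `0 / 0 = 0` agrees with the right side, where `V = 0`.
  · rw [h] at hV ⊢
    simp [Nat.le_zero.1 hV]
  · have hτ : 0 < tauSU (critVal α δ n) p := hk ▸ critVal_pos hα hδ hδ' k
    have hR : (0 : ℝ) < numRej p (tauSU (critVal α δ n) p) := by rw [h]; positivity
    rw [div_eq_div_iff hR.ne' (by positivity)]
    generalize tauSU (critVal α δ n) p = t at *
    field_simp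
    linear_combination -(numFalseRej I₀ p t : ℝ) * hm

end CritVal

/-! ### Measurability of counts and threshold. -/

section Measurability

variable {n : ℕ} {a : Fin n → ℝ}

@[fun_prop]
lemma measurable_numFalseRej (I₀ : Finset (Fin n)) {f : (Fin n → ℝ) → ℝ} (hf : Measurable f) :
    Measurable fun p : Fin n → ℝ => (numFalseRej I₀ p (f p) : ℝ) := by
  simp only [numFalseRej_eq_sum]
  exact Finset.measurable_sum _ fun i _ =>
    Measurable.ite (measurableSet_le (measurable_pi_apply i) hf) measurable_const measurable_const

lemma measurable_numRej (t : ℝ) : Measurable fun p : Fin n → ℝ => numRej p t := by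
  have h : Measurable fun p : Fin n → ℝ => ∑ i, if p i ≤ t then 1 else 0 :=
    Finset.measurable_sum _ fun i _ => Measurable.ite
      (measurableSet_le (measurable_pi_apply i) measurable_const) measurable_const measurable_const
  simpa [numRej] using h

lemma tauSU_le_iff (ha : ∀ k, 0 < a k) (p : Fin n → ℝ) (t : ℝ) :
    tauSU a p ≤ t ↔ 0 ≤ t ∧ ∀ k : Fin n, (k : ℕ) < numRej p (a k) → a k ≤ t := by
  refine ⟨fun h => ⟨(tauSU_nonneg ha).trans h, fun k hk => (le_tauSU hk).trans h⟩, fun h => ?_⟩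
  rcases tauSU_cases a p with h0 | ⟨k, hk, hlt⟩
  · exact h0.1 ▸ h.1
  · exact hk ▸ h.2 k hlt

lemma measurable_tauSU (ha : ∀ k, 0 < a k) : Measurable (tauSU a) := by
  refine measurable_of_Iic fun t => ?_
  have : tauSU a ⁻¹' Set.Iic t =
      {p | 0 ≤ t ∧ ∀ k : Fin n, (k : ℕ) < numRej p (a k) → a k ≤ t} := by
    ext p
    exact tauSU_le_iff ha p t
  rw [this]
  have h : {p : Fin n → ℝ | 0 ≤ t ∧ ∀ k : Fin n, (k : ℕ) < numRej p (a k) → a k ≤ t} =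
      {_p | 0 ≤ t} ∩ ⋂ k : Fin n, ({p | (k : ℕ) < numRej p (a k)}ᶜ ∪ {_p | a k ≤ t}) := by
    ext p
    simp [imp_iff_not_or]
  rw [h]
  exact (MeasurableSet.const _).inter (MeasurableSet.iInter fun k =>
    (measurableSet_lt measurable_const (measurable_numRej _)).compl.union (MeasurableSet.const _))

end Measurability

/-! ### Independence of one true p-value from the rest. -/

section Independence

/-- The joint law is a product of three measures; only the bracketing changes. It merges
independence among the true nulls with independence between the two groups. -/
lemma indepFun_prodMk_right {Ω β γ ε : Type*} [MeasurableSpace Ω] [MeasurableSpace β]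
    [MeasurableSpace γ] [MeasurableSpace ε] {μ : Measure Ω} [IsProbabilityMeasure μ]
    {X : Ω → β} {Y : Ω → γ} {Z : Ω → ε} (hX : Measurable X) (hY : Measurable Y)
    (hZ : Measurable Z) (hXY : IndepFun X Y μ) (hXYZ : IndepFun (fun ω => (X ω, Y ω)) Z μ) :
    IndepFun X (fun ω => (Y ω, Z ω)) μ := by
  have := Measure.isProbabilityMeasure_map (μ := μ) hX.aemeasurable
  have := Measure.isProbabilityMeasure_map (μ := μ) hY.aemeasurable
  have := Measure.isProbabilityMeasure_map (μ := μ) hZ.aemeasurable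
  have hYZ : IndepFun Y Z μ := hXYZ.comp measurable_snd measurable_id
  rw [indepFun_iff_map_prod_eq_prod_map_map (by fun_prop) (by fun_prop)] at *
  rw [hYZ, ← Measure.prodAssoc_prod, ← hXY, ← hXYZ,
    Measure.map_map (by fun_prop) (by fun_prop)]
  rfl

variable {n : ℕ} {I₀ : Finset (Fin n)} {P : Measure (Fin n → ℝ)}

/-- A true p-value is independent of all the others. -/
lemma IsBIA.indepFun_update (h : IsBIA I₀ P) {i : Fin n} (hi : i ∈ I₀) :
    IndepFun (fun p : Fin n → ℝ => p i) (fun p => Function.update p i 0) P := by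
  have := h.isProb
  set X' : (Fin n → ℝ) → ({j // j ∈ I₀} → ℝ) := fun p j => if (j : Fin n) = i then 0 else p j
    with hX'
  have hX'm : Measurable X' := measurable_pi_lambda _ fun j => by
    by_cases hj : (j : Fin n) = i
    · simp [hX', hj]
    · simp only [hX', hj, if_false]; fun_prop
  have h1 : IndepFun (fun p : Fin n → ℝ => p i) X' P := by
    have := h.indep_true.indepFun_finset {⟨i, hi⟩} {⟨i, hi⟩}ᶜ disjoint_compl_right
      (fun j => by fun_prop)
    let G : (({⟨i, hi⟩}ᶜ : Finset {j // j ∈ I₀}) → ℝ) → ({j // j ∈ I₀} → ℝ) := fun z j =>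
      if hj : (j : Fin n) = i then 0 else z ⟨j, by simpa [Subtype.ext_iff] using hj⟩
    have hG : Measurable G := measurable_pi_lambda _ fun j => by
      by_cases hj : (j : Fin n) = i
      · simp [G, hj]
      · simp only [G, hj, dite_false]; fun_prop
    let G₀ : (({⟨i, hi⟩} : Finset {j // j ∈ I₀}) → ℝ) → ℝ := fun z => z ⟨⟨i, hi⟩, by simp⟩
    have hG₀ : Measurable G₀ := measurable_pi_apply _
    have h' := this.comp hG₀ hG
    have hGX : (G ∘ fun (p : Fin n → ℝ) (j : ({⟨i, hi⟩}ᶜ : Finset {j // j ∈ I₀})) =>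
        p (j : {j // j ∈ I₀})) = X' := by
      funext p j
      by_cases hj : (j : Fin n) = i <;> simp [hX', G, hj]
    rwa [hGX] at h'
  have h2 : IndepFun (fun p : Fin n → ℝ => (p i, X' p))
      (fun p (j : {j // j ∉ I₀}) => p j) P := by
    let F : ({j // j ∈ I₀} → ℝ) → ℝ × ({j // j ∈ I₀} → ℝ) := fun x =>
      (x ⟨i, hi⟩, fun j => if (j : Fin n) = i then 0 else x j)
    have hF : Measurable F := by
      refine Measurable.prodMk (by fun_prop) (measurable_pi_lambda _ fun j => ?_)
      by_cases hj : (j : Fin n) = i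
      · simp [hj]
      · simp only [hj, if_false]; fun_prop
    exact h.indep_groups.comp (φ := F) (ψ := id) hF measurable_id
  have h3 := indepFun_prodMk_right (by fun_prop) hX'm (by fun_prop) h1 h2
  let K : ({j // j ∈ I₀} → ℝ) × ({j // j ∉ I₀} → ℝ) → (Fin n → ℝ) := fun z j =>
    if hj : j ∈ I₀ then z.1 ⟨j, hj⟩ else z.2 ⟨j, hj⟩
  have hK : Measurable K := measurable_pi_lambda _ fun j => by
    by_cases hj : j ∈ I₀
    · simp only [K, hj, dite_true]; fun_prop
    · simp only [K, hj, dite_false]; fun_prop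
  have h4 := h3.comp (φ := id) measurable_id hK
  have hKX : (K ∘ fun p : Fin n → ℝ => (X' p, fun j : {j // j ∉ I₀} => p j)) =
      fun p => Function.update p i 0 := by
    funext p j
    by_cases hj : j ∈ I₀
    · by_cases hji : j = i
      · subst hji; simp [K, hj, hX']
      · simp [K, hj, hji, hX']
    · have hji : j ≠ i := fun e => hj (e ▸ hi)
      simp [K, hj, hji]
  rwa [hKX] at h4

end Independence

/-! ### Leave-one-out evaluation of the FDR. -/

section LeaveOneOut

variable {n : ℕ} {I₀ : Finset (Fin n)} {P : Measure (Fin n → ℝ)} {a : Fin n → ℝ}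

lemma measurableSet_update_eq (ha : ∀ k, 0 < a k) (i k : Fin n) :
    MeasurableSet {p : Fin n → ℝ | tauSU a (Function.update p i 0) = a k} :=
  ((measurable_tauSU ha).comp measurable_update_left) (measurableSet_singleton (a k))

lemma integral_indicator_div_tauSU (h : IsBIA I₀ P) (hmono : StrictMono a) (ha : ∀ k, 0 < a k)
    {i : Fin n} (hi : i ∈ I₀) :
    Integrable (fun p : Fin n → ℝ => if p i ≤ tauSU a p then (tauSU a p)⁻¹ else 0) P ∧
    ∫ p, (if p i ≤ tauSU a p then (tauSU a p)⁻¹ else 0) ∂P =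
      ∑ k, P.real {p | p i ≤ a k} *
        P.real {p | tauSU a (Function.update p i 0) = a k} * (a k)⁻¹ := by
  have := h.isProb
  simp only [indicator_div_tauSU_eq_sum hmono ha]
  have hset : ∀ k, MeasurableSet
      {p : Fin n → ℝ | p i ≤ a k ∧ tauSU a (Function.update p i 0) = a k} := fun k =>
    (measurableSet_le (measurable_pi_apply i) measurable_const).inter
      (measurableSet_update_eq ha i k)
  have hfun : ∀ k, (fun p : Fin n → ℝ =>
      if p i ≤ a k ∧ tauSU a (Function.update p i 0) = a k then (a k)⁻¹ else 0) =
      {p : Fin n → ℝ | p i ≤ a k ∧ tauSU a (Function.update p i 0) = a k}.indicator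
        fun _ => (a k)⁻¹ := fun k => by
    ext p
    simp [Set.indicator_apply]
  have hint : ∀ k, Integrable (fun p : Fin n → ℝ =>
      if p i ≤ a k ∧ tauSU a (Function.update p i 0) = a k then (a k)⁻¹ else 0) P := fun k =>
    hfun k ▸ (integrable_const ((a k)⁻¹)).indicator (hset k)
  refine ⟨integrable_finsetSum _ fun k _ => hint k, ?_⟩
  rw [integral_finsetSum _ fun k _ => hint k]
  refine Finset.sum_congr rfl fun k _ => ?_
  have h1 := integral_indicator_const (μ := P) ((a k)⁻¹) (hset k)
  have h2 := (h.indepFun_update hi).measure_inter_preimage_eq_mul (Set.Iic (a k))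
    (tauSU a ⁻¹' {a k}) measurableSet_Iic (measurable_tauSU ha (measurableSet_singleton _))
  have h3 : P.real {p | p i ≤ a k ∧ tauSU a (Function.update p i 0) = a k} =
      P.real {p | p i ≤ a k} * P.real {p | tauSU a (Function.update p i 0) = a k} := by
    unfold Measure.real
    rw [← ENNReal.toReal_mul]
    exact congrArg ENNReal.toReal h2
  rw [← h3, hfun]
  exact h1

lemma sum_measureReal_tauSU_update [IsProbabilityMeasure P] (hmono : StrictMono a)
    (ha : ∀ k, 0 < a k) (i : Fin n) :
    ∑ k, P.real {p | tauSU a (Function.update p i 0) = a k} = 1 := by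
  rw [← measureReal_biUnion_finset]
  · have : (⋃ k ∈ (Finset.univ : Finset (Fin n)),
        {p : Fin n → ℝ | tauSU a (Function.update p i 0) = a k}) = Set.univ := by
      ext p
      simpa using tauSU_update_pos ha p i
    rw [this]
    simp
  · intro j _ k _ hjk
    refine Set.disjoint_left.2 fun p hj hk => hjk (hmono.injective ?_)
    exact (Eq.symm hj).trans hk
  · exact fun k _ => measurableSet_update_eq ha i k

/-- Superuniformity cancels the factor `(a k)⁻¹`, leaving the total probability of the values of the
zeroed threshold. -/
lemma integral_indicator_div_tauSU_le (h : IsBIA I₀ P) (hmono : StrictMono a)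
    (ha : ∀ k, 0 < a k) (ha1 : ∀ k, a k ≤ 1) {i : Fin n} (hi : i ∈ I₀) :
    ∫ p, (if p i ≤ tauSU a p then (tauSU a p)⁻¹ else 0) ∂P ≤ 1 := by
  have := h.isProb
  rw [(integral_indicator_div_tauSU h hmono ha hi).2,
    ← sum_measureReal_tauSU_update (P := P) hmono ha i]
  refine Finset.sum_le_sum fun k _ => ?_
  have h1 := h.superuniform i hi (a k) ⟨(ha k).le, ha1 k⟩
  rw [← div_eq_mul_inv, div_le_iff₀ (ha k), mul_comm]
  exact mul_le_mul_of_nonneg_left h1 measureReal_nonneg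

lemma integral_indicator_div_tauSU_eq (h : IsBIA I₀ P) (hmono : StrictMono a)
    (ha : ∀ k, 0 < a k) {i : Fin n} (hi : i ∈ I₀)
    (hu : ∀ k, P.real {p | p i ≤ a k} = a k) :
    ∫ p, (if p i ≤ tauSU a p then (tauSU a p)⁻¹ else 0) ∂P = 1 := by
  have := h.isProb
  rw [(integral_indicator_div_tauSU h hmono ha hi).2,
    ← sum_measureReal_tauSU_update (P := P) hmono ha i]
  refine Finset.sum_congr rfl fun k _ => ?_
  rw [hu, mul_comm (a k), mul_assoc, mul_inv_cancel₀ (ha k).ne', mul_one]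

lemma integrable_numFalseRej [IsProbabilityMeasure P] (I₀ : Finset (Fin n))
    {f : (Fin n → ℝ) → ℝ} (hf : Measurable f) :
    Integrable (fun p : Fin n → ℝ => (numFalseRej I₀ p (f p) : ℝ)) P := by
  refine Integrable.of_bound (measurable_numFalseRej I₀ hf).aestronglyMeasurable I₀.card
    (ae_of_all _ fun p => ?_)
  rw [Real.norm_natCast]
  exact_mod_cast numFalseRej_le_card I₀ p _

variable {α δ : ℝ}

lemma fdrSU_eq (h : IsBIA I₀ P) (hα : 0 < α) (hδ : 0 ≤ δ) (hδ' : δ < 1 - α) :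
    fdrSU (critVal α δ n) I₀ P =
      (α * (∑ i ∈ I₀, ∫ p, (if p i ≤ tauSU (critVal α δ n) p then
        (tauSU (critVal α δ n) p)⁻¹ else 0) ∂P) +
        δ * ∫ p, (numFalseRej I₀ p (tauSU (critVal α δ n) p) : ℝ) ∂P) / (n + 1) := by
  have := h.isProb
  have hm := critVal_strictMono (n := n) hα hδ hδ'
  have hp := critVal_pos (n := n) hα hδ hδ'
  unfold fdrSU
  simp only [fdp_eq hα hδ hδ']
  rw [integral_div, integral_add, integral_const_mul, integral_const_mul, integral_finsetSum]
  · exact fun i hi => (integral_indicator_div_tauSU h hm hp hi).1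
  · exact (integrable_finsetSum _ fun i hi =>
      (integral_indicator_div_tauSU h hm hp hi).1).const_mul _
  · exact (integrable_numFalseRej I₀ (measurable_tauSU hp)).const_mul _

/-- The FDR bound in terms of the expected number of false rejections. -/
lemma fdrSU_le (h : IsBIA I₀ P) (hα : 0 < α) (hδ : 0 ≤ δ) (hδ' : δ < 1 - α) :
    fdrSU (critVal α δ n) I₀ P ≤ (α * I₀.card +
        δ * ∫ p, (numFalseRej I₀ p (tauSU (critVal α δ n) p) : ℝ) ∂P) / (n + 1) := by
  rw [fdrSU_eq h hα hδ hδ']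
  have : ∑ i ∈ I₀, ∫ p, (if p i ≤ tauSU (critVal α δ n) p then
        (tauSU (critVal α δ n) p)⁻¹ else 0) ∂P ≤ ∑ i ∈ I₀, 1 :=
    Finset.sum_le_sum fun i hi => integral_indicator_div_tauSU_le h
      (critVal_strictMono hα hδ hδ') (critVal_pos hα hδ hδ') (critVal_le_one hα hδ hδ') hi
  simp only [Finset.sum_const, nsmul_eq_mul, mul_one] at this
  gcongr

lemma fdrSU_eq_of_uniform (h : IsBIA I₀ P) (hα : 0 < α) (hδ : 0 ≤ δ) (hδ' : δ < 1 - α)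
    (hu : ∀ i ∈ I₀, ∀ x ∈ Set.Icc (0 : ℝ) 1, P.real {p | p i ≤ x} = x) :
    fdrSU (critVal α δ n) I₀ P = (α * I₀.card +
        δ * ∫ p, (numFalseRej I₀ p (tauSU (critVal α δ n) p) : ℝ) ∂P) / (n + 1) := by
  rw [fdrSU_eq h hα hδ hδ', Finset.sum_congr rfl fun i hi => integral_indicator_div_tauSU_eq h
      (critVal_strictMono hα hδ hδ') (critVal_pos hα hδ hδ') hi fun k =>
        hu i hi _ ⟨(critVal_pos hα hδ hδ' k).le, critVal_le_one hα hδ hδ' k⟩]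
  simp

lemma fdrSU_le_one [IsProbabilityMeasure P] (a : Fin n → ℝ) (I₀ : Finset (Fin n)) :
    fdrSU a I₀ P ≤ 1 := by
  have h : ∫ p, (numFalseRej I₀ p (tauSU a p) : ℝ) / (numRej p (tauSU a p) : ℝ) ∂P
      ≤ ∫ _, (1 : ℝ) ∂P := by
    refine integral_mono_of_nonneg (ae_of_all _ fun p => by positivity) (integrable_const _)
      (ae_of_all _ fun p => div_le_one_of_le₀ ?_ (by positivity))
    exact_mod_cast numFalseRej_le_numRej I₀ p _
  simpa [fdrSU] using h

end LeaveOneOut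

/-! ### Concentration of the number of false rejections. -/

section Concentration

variable {n : ℕ} {I₀ : Finset (Fin n)} {P : Measure (Fin n → ℝ)}

lemma integral_numFalseRej_le (h : IsBIA I₀ P) {t : ℝ} (ht : t ∈ Set.Icc (0 : ℝ) 1) :
    ∫ p, (numFalseRej I₀ p t : ℝ) ∂P ≤ I₀.card * t := by
  have := h.isProb
  simp only [numFalseRej_eq_sum]
  have hset : ∀ i : Fin n, MeasurableSet {p : Fin n → ℝ | p i ≤ t} := fun i =>
    measurableSet_le (measurable_pi_apply i) measurable_const
  have hfun : ∀ i : Fin n, (fun p : Fin n → ℝ => if p i ≤ t then (1 : ℝ) else 0) =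
      {p : Fin n → ℝ | p i ≤ t}.indicator fun _ => 1 := fun i => by
    ext p
    simp [Set.indicator_apply]
  rw [integral_finsetSum _ fun i _ => hfun i ▸ (integrable_const (1 : ℝ)).indicator (hset i)]
  have : ∑ i ∈ I₀, ∫ p : Fin n → ℝ, (if p i ≤ t then (1 : ℝ) else 0) ∂P ≤ ∑ i ∈ I₀, t := by
    refine Finset.sum_le_sum fun i hi => ?_
    rw [hfun, integral_indicator_const _ (hset i), smul_eq_mul, mul_one]
    exact h.superuniform i hi t ht
  simpa using this

lemma variance_numFalseRej_le (h : IsBIA I₀ P) (t : ℝ) :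
    Var[fun p => (numFalseRej I₀ p t : ℝ); P] ≤ I₀.card := by
  have := h.isProb
  set X : Fin n → (Fin n → ℝ) → ℝ := fun i p => if p i ≤ t then 1 else 0 with hX
  have hφ : Measurable fun y : ℝ => if y ≤ t then (1 : ℝ) else 0 :=
    Measurable.ite measurableSet_Iic measurable_const measurable_const
  have hXm : ∀ i, Measurable (X i) := fun i => hφ.comp (measurable_pi_apply i)
  have hb : ∀ i p, X i p ∈ Set.Icc (0 : ℝ) 1 := fun i p => by
    by_cases hp : p i ≤ t <;> simp [hX, hp]
  have hfun : (fun p => (numFalseRej I₀ p t : ℝ)) = ∑ i ∈ I₀, X i := by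
    ext p
    simp [numFalseRej_eq_sum, hX]
  have hL : ∀ i, MemLp (X i) 2 P := fun i => MemLp.of_bound (hXm i).aestronglyMeasurable 1
    (ae_of_all _ fun p => by
      rw [Real.norm_eq_abs, abs_le]
      exact ⟨by linarith [(hb i p).1], (hb i p).2⟩)
  rw [hfun, IndepFun.variance_sum (fun i _ => hL i)]
  · have : ∑ i ∈ I₀, Var[X i; P] ≤ ∑ i ∈ I₀, 1 := Finset.sum_le_sum fun i _ => by
      refine (variance_le_sq_of_bounded (ae_of_all _ (hb i)) (hXm i).aemeasurable).trans ?_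
      norm_num
    simpa using this
  · intro i hi j hj hij
    exact (h.indep_true.indepFun (i := ⟨i, hi⟩) (j := ⟨j, hj⟩)
      (by simpa [Subtype.ext_iff] using hij)).comp hφ hφ

/-- Chebyshev: the mean is at most `n₀ t` and the variance at most `n₀ ≤ n`. Only the upper tail is
controlled, as true p-values may be far above uniform. -/
lemma measureReal_numFalseRej_ge_le (h : IsBIA I₀ P) (hn : 0 < n) {t ε : ℝ}
    (ht : t ∈ Set.Icc (0 : ℝ) 1) (hε : 0 < ε) :
    P.real {p | I₀.card * t + n * ε ≤ numFalseRej I₀ p t} ≤ 1 / (n * ε ^ 2) := by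
  have := h.isProb
  have hn' : (0 : ℝ) < n := by exact_mod_cast hn
  have hL : MemLp (fun p => (numFalseRej I₀ p t : ℝ)) 2 P :=
    MemLp.of_bound (measurable_numFalseRej I₀ measurable_const).aestronglyMeasurable I₀.card
      (ae_of_all _ fun p => by
        rw [Real.norm_natCast]
        exact_mod_cast numFalseRej_le_card I₀ p _)
  have hc := meas_ge_le_variance_div_sq hL (c := n * ε) (by positivity)
  have hsub : {p | (I₀.card : ℝ) * t + n * ε ≤ numFalseRej I₀ p t} ⊆
      {p | n * ε ≤ |(numFalseRej I₀ p t : ℝ) - ∫ p, (numFalseRej I₀ p t : ℝ) ∂P|} := by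
    intro p hp
    have hp' : (I₀.card : ℝ) * t + n * ε ≤ numFalseRej I₀ p t := hp
    have := integral_numFalseRej_le h ht
    rw [Set.mem_ofPred_eq]
    refine le_trans ?_ (le_abs_self _)
    linarith
  have hcard : (I₀.card : ℝ) ≤ n := by
    exact_mod_cast (Finset.card_le_univ I₀).trans_eq (Fintype.card_fin n)
  refine (measureReal_mono hsub).trans ((ENNReal.toReal_le_of_le_ofReal (by
    have := variance_nonneg (fun p => (numFalseRej I₀ p t : ℝ)) P
    positivity) hc).trans ?_)
  rw [div_le_div_iff₀ (by positivity) (by positivity)]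
  have := variance_numFalseRej_le h t
  calc _ ≤ (n : ℝ) * (n * ε ^ 2) := by gcongr; exact this.trans hcard
    _ = 1 * (n * ε) ^ 2 := by ring

/-- Control of `V(t)` on a grid controls it everywhere. -/
lemma numFalseRej_le_of_grid {p : Fin n → ℝ} {K : ℕ} (hK : 0 < K) {ε : ℝ}
    (hKε : 1 / (K : ℝ) ≤ ε)
    (hp : ∀ j ∈ Finset.range (K + 1), (numFalseRej I₀ p (j / K) : ℝ) ≤
      I₀.card * (j / K) + n * ε) {t : ℝ} (ht : t ∈ Set.Icc (0 : ℝ) 1) :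
    (numFalseRej I₀ p t : ℝ) ≤ I₀.card * t + n * (2 * ε) := by
  have hK' : (0 : ℝ) < K := by exact_mod_cast hK
  have hcard : (I₀.card : ℝ) ≤ n := by
    exact_mod_cast (Finset.card_le_univ I₀).trans_eq (Fintype.card_fin n)
  have hj : ⌈t * K⌉₊ ∈ Finset.range (K + 1) := by
    rw [Finset.mem_range, Nat.lt_succ_iff, Nat.ceil_le]
    nlinarith [ht.2]
  have h1 : t ≤ (⌈t * K⌉₊ : ℝ) / K := by
    rw [le_div_iff₀ hK']
    exact Nat.le_ceil _
  have h2 : (⌈t * K⌉₊ : ℝ) / K ≤ t + ε := by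
    have := Nat.ceil_lt_add_one (a := t * K) (by have := ht.1; positivity)
    calc (⌈t * K⌉₊ : ℝ) / K ≤ (t * K + 1) / K := by gcongr
      _ = t + 1 / K := by field_simp
      _ ≤ t + ε := by gcongr
  have hε : 0 ≤ ε := le_trans (by positivity) hKε
  calc (numFalseRej I₀ p t : ℝ) ≤ numFalseRej I₀ p ((⌈t * K⌉₊ : ℝ) / K) := by
        exact_mod_cast numFalseRej_mono I₀ p h1
    _ ≤ I₀.card * ((⌈t * K⌉₊ : ℝ) / K) + n * ε := hp _ hj
    _ ≤ I₀.card * (t + ε) + n * ε := by gcongr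
    _ = I₀.card * t + I₀.card * ε + n * ε := by ring
    _ ≤ I₀.card * t + n * ε + n * ε := by gcongr
    _ = I₀.card * t + n * (2 * ε) := by ring

end Concentration

/-! ### Upper bound uniform over the model. -/

section UpperBound

/-- Here `c`, `v` stand for `n₀ / n`, `V / n`. Up to `O(ε)` the constraints say `c (1 - τ)(α + d τ)
≤ α - (1 - d) τ`, with equality at `τ = x`, `c = c₀`. Below `x` the quantity `c (α + d τ)` is at
most `L` by monotonicity; above `x`, the constraint itself bounds it. -/
lemma threshold_bound {α δ d x L c₀ c η ε τ v : ℝ} (hα : 0 < α) (hδ : 0 ≤ δ) (hd : 0 ≤ d)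
    (hη : 0 < η) (hdη : α + d ≤ 1 - η) (hδd : |δ - d| ≤ ε) (hεη : 10 * ε ≤ η)
    (hδ1 : δ ≤ 1) (hL : L = c₀ * (α + d * x)) (hLx : L * (1 - x) = α - (1 - d) * x)
    (hLα : L ≤ α) (hc : 0 ≤ c) (hcc : c ≤ c₀) (hc1 : c ≤ 1) (hτ0 : 0 ≤ τ)
    (hτ1 : τ ≤ 1) (hv : v ≤ c * τ + 2 * ε) (hτv : τ ≤ (α + δ * τ) * (1 - c + v)) :
    α * c + δ * v ≤ L + (10 / η + 3) * ε := by
  have hε : 0 ≤ ε := (abs_nonneg _).trans hδd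
  have hδd' := (abs_le.1 hδd).2
  have hA : 0 ≤ α + d * τ := by positivity
  have hA1 : α + d * τ ≤ 1 := by nlinarith
  have hB : 0 ≤ 1 - c * (1 - τ) := by nlinarith
  have hcτ : 0 ≤ c * (1 - τ) := mul_nonneg hc (by linarith)
  have hδτ : δ * τ ≤ d * τ + ε := by nlinarith
  have hmain : c * (1 - τ) * (α + d * τ) ≤ α - (1 - d) * τ + 5 * ε := by
    have h1 : τ ≤ (α + d * τ + ε) * (1 - c * (1 - τ) + 2 * ε) :=
      hτv.trans (mul_le_mul_of_nonneg (by linarith) (by linarith) (by positivity) (by linarith))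
    nlinarith
  have hτη : η / 2 ≤ 1 - τ := by
    have h0 : 0 ≤ α - (1 - d) * τ + 5 * ε := le_trans (by positivity) hmain
    nlinarith
  have hkey : c * (α + d * τ) ≤ L + 10 / η * ε := by
    have hη' : 0 ≤ 10 / η * ε := by positivity
    rcases le_total τ x with h | h
    · have hx : 0 ≤ x := hτ0.trans h
      have : c * (α + d * τ) ≤ c₀ * (α + d * x) := by gcongr; linarith
      linarith
    -- Subtract `L (1 - τ) ≥ α - (1 - d) τ`, which follows from `hLx` because `L ≤ α ≤ 1 - d` and `τ
    -- ≥ x`. Dividing by `1 - τ ≥ η / 2` produces the constant `10 / η`.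
    · have h1 : (1 - τ) * (c * (α + d * τ) - L) ≤ 5 * ε := by nlinarith
      by_contra hcon
      push Not at hcon
      have h2 : 10 / η * ε < c * (α + d * τ) - L := by linarith
      have h3 : η / 2 * (10 / η * ε) < (1 - τ) * (c * (α + d * τ) - L) :=
        mul_lt_mul_of_le_of_lt_of_nonneg_of_pos hτη h2 hη' (by linarith)
      have h4 : η / 2 * (10 / η * ε) = 5 * ε := by field_simp; ring
      linarith
  have h5 : δ * v ≤ δ * (c * τ + 2 * ε) := mul_le_mul_of_nonneg_left hv hδ
  have h6 : c * (δ * τ) ≤ c * (d * τ + ε) := mul_le_mul_of_nonneg_left hδτ hc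
  nlinarith

variable {n : ℕ} {I₀ : Finset (Fin n)} {P : Measure (Fin n → ℝ)}

lemma fdrSU_le_add {α δ d x L c₀ η ε : ℝ} {K : ℕ} (h : IsBIA I₀ P) (hn : 0 < n) (hα : 0 < α)
    (hδ : 0 ≤ δ) (hδ' : δ < 1 - α) (hd : 0 ≤ d)
    (hη : 0 < η) (hdη : α + d ≤ 1 - η) (hε : 0 < ε) (hδd : |δ - d| ≤ ε) (hεη : 10 * ε ≤ η)
    (hL0 : 0 ≤ L) (hL : L = c₀ * (α + d * x))
    (hLx : L * (1 - x) = α - (1 - d) * x)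
    (hLα : L ≤ α) (hcard : (I₀.card : ℝ) ≤ c₀ * n) (hK : 0 < K) (hKε : 1 / (K : ℝ) ≤ ε) :
    fdrSU (critVal α δ n) I₀ P ≤ L + (10 / η + 3) * ε + (K + 1) * (1 / (n * ε ^ 2)) := by
  have := h.isProb
  have hn' : (0 : ℝ) < n := by exact_mod_cast hn
  have hp := critVal_pos (n := n) hα hδ hδ'
  have hcardn : (I₀.card : ℝ) ≤ n := by
    exact_mod_cast (Finset.card_le_univ I₀).trans_eq (Fintype.card_fin n)
  set τ : (Fin n → ℝ) → ℝ := tauSU (critVal α δ n) with hτ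
  -- The bad event: some grid point `j / K` has too many true p-values below it.
  set B : Set (Fin n → ℝ) := ⋃ j ∈ Finset.range (K + 1),
    {p | (I₀.card : ℝ) * ((j : ℝ) / K) + n * ε ≤ numFalseRej I₀ p ((j : ℝ) / K)} with hB
  have hBm : MeasurableSet B := by
    refine MeasurableSet.biUnion (Finset.countable_toSet _) fun j _ => ?_
    exact measurableSet_le measurable_const (measurable_numFalseRej I₀ measurable_const)
  have hPB : P.real B ≤ (K + 1) * (1 / (n * ε ^ 2)) := by
    refine (measureReal_biUnion_finset_le _ _).trans ?_
    have : ∀ j ∈ Finset.range (K + 1),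
        P.real {p | (I₀.card : ℝ) * ((j : ℝ) / K) + n * ε ≤ numFalseRej I₀ p ((j : ℝ) / K)} ≤
          1 / (n * ε ^ 2) := fun j hj => by
      refine measureReal_numFalseRej_ge_le h hn ⟨by positivity, ?_⟩ hε
      refine div_le_one_of_le₀ ?_ (by positivity)
      exact_mod_cast Nat.lt_succ_iff.1 (Finset.mem_range.1 hj)
    simpa using Finset.sum_le_sum this
  have hpt : ∀ p, (α * I₀.card + δ * numFalseRej I₀ p (τ p)) / n ≤
      (L + (10 / η + 3) * ε) + B.indicator (fun _ => (1 : ℝ)) p := by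
    intro p
    have hVc : (numFalseRej I₀ p (τ p) : ℝ) ≤ I₀.card := by
      exact_mod_cast numFalseRej_le_card I₀ p _
    by_cases hpB : p ∈ B
    · rw [Set.indicator_of_mem hpB]
      have h1 : (α * I₀.card + δ * numFalseRej I₀ p (τ p)) / n ≤ 1 := by
        rw [div_le_one hn']
        nlinarith
      have : 0 ≤ (10 / η + 3) * ε := by positivity
      linarith
    · rw [Set.indicator_of_notMem hpB, add_zero]
      have hgrid : ∀ j ∈ Finset.range (K + 1), (numFalseRej I₀ p (j / K) : ℝ) ≤
          I₀.card * (j / K) + n * ε := fun j hj => by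
        by_contra hcon
        exact hpB (Set.mem_biUnion hj (not_le.1 hcon).le)
      have hτ0 : 0 ≤ τ p := tauSU_nonneg hp
      have hτ1 : τ p ≤ 1 := tauSU_critVal_le_one hα hδ hδ' p
      have hV := numFalseRej_le_of_grid hK hKε hgrid ⟨hτ0, hτ1⟩
      have hR := numRej_mul_eq hα hδ hδ' p
      have hR' := numRej_le_add I₀ p (τ p)
      have hα' : 0 ≤ α + δ * τ p := by positivity
      have hres := threshold_bound (c := I₀.card / n) (v := numFalseRej I₀ p (τ p) / n)
        (τ := τ p) hα hδ hd hη hdη hδd hεη (by linarith) hL hLx hLα (by positivity)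
        ((div_le_iff₀ hn').2 hcard) ((div_le_one hn').2 hcardn) hτ0 hτ1
        (by
          rw [div_le_iff₀ hn']
          refine hV.trans_eq ?_
          field_simp) (by
          have : 1 - (I₀.card : ℝ) / n + numFalseRej I₀ p (τ p) / n =
            (numFalseRej I₀ p (τ p) + (n - I₀.card)) / n := by field_simp; ring
          rw [this, ← mul_div_assoc, le_div_iff₀ hn']
          calc τ p * n ≤ (n + 1) * τ p := by linarith
            _ = numRej p (τ p) * (α + δ * τ p) := hR.symm
            _ ≤ _ := by rw [mul_comm]; gcongr)
      refine le_trans (le_of_eq ?_) hres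
      ring
  have hVint := integrable_numFalseRej (P := P) I₀ (measurable_tauSU hp)
  have hind : Integrable (B.indicator fun _ => (1 : ℝ)) P := (integrable_const 1).indicator hBm
  have hVnn : 0 ≤ ∫ p, (numFalseRej I₀ p (τ p) : ℝ) ∂P := integral_nonneg fun p => by positivity
  calc fdrSU (critVal α δ n) I₀ P
      ≤ (α * I₀.card + δ * ∫ p, (numFalseRej I₀ p (τ p) : ℝ) ∂P) / (n + 1) :=
        fdrSU_le h hα hδ hδ'
    _ ≤ (α * I₀.card + δ * ∫ p, (numFalseRej I₀ p (τ p) : ℝ) ∂P) / n := by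
        gcongr; linarith
    _ = ∫ p, (α * I₀.card + δ * numFalseRej I₀ p (τ p)) / n ∂P := by
        rw [integral_div, integral_add (integrable_const _) (hVint.const_mul _),
          integral_const_mul δ]
        simp [hτ]
    _ ≤ ∫ p, (L + (10 / η + 3) * ε) + B.indicator (fun _ => (1 : ℝ)) p ∂P :=
        integral_mono ((((integrable_const _).add (hVint.const_mul _))).div_const _)
          ((integrable_const _).add hind) hpt
    _ = L + (10 / η + 3) * ε + P.real B := by
        rw [integral_add (integrable_const _) hind, integral_indicator_const _ hBm]
        simp
    _ ≤ _ := by gcongr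

/-- Asymptotic bound for the FDR, uniform over the basic independence model. -/
lemma exists_forall_fdrSU_le {α η e : ℝ} (hα : 0 < α) (hη : 0 < η) (he : 0 < e) :
    ∃ ε > 0, ∃ N : ℕ, ∀ n ≥ N, ∀ δ d x L c₀ : ℝ, 0 ≤ δ → δ < 1 - α → 0 ≤ d →
      α + d ≤ 1 - η → |δ - d| ≤ ε → 0 ≤ L → L = c₀ * (α + d * x) →
      L * (1 - x) = α - (1 - d) * x → L ≤ α →
      ∀ (I₀ : Finset (Fin n)) (P : Measure (Fin n → ℝ)), IsBIA I₀ P →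
        (I₀.card : ℝ) ≤ c₀ * n → fdrSU (critVal α δ n) I₀ P ≤ L + e := by
  obtain ⟨ε, hε, hεη, hεe⟩ : ∃ ε > 0, 10 * ε ≤ η ∧ (10 / η + 3) * ε ≤ e / 2 := by
    refine ⟨min (η / 10) (e / 2 / (10 / η + 3)), by positivity, ?_, ?_⟩
    · have := min_le_left (η / 10) (e / 2 / (10 / η + 3))
      linarith
    · have := min_le_right (η / 10) (e / 2 / (10 / η + 3))
      rwa [le_div_iff₀' (by positivity)] at this
  obtain ⟨K, hK⟩ := exists_nat_gt (1 / ε)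
  have hK0 : (0 : ℝ) < K := lt_trans (by positivity) hK
  obtain ⟨N, hN⟩ := exists_nat_gt ((K + 1) / ε ^ 2 / (e / 2))
  -- `ε` and `N` are fixed before `d`, `x`, `L`, `c₀`, so `d` may vary with `n`.
  refine ⟨ε, hε, N, fun n hn δ d x L c₀ hδ hδ' hd hdη hδd hL0 hL hLx hLα I₀ P h hcard => ?_⟩
  have hNn : (N : ℝ) ≤ n := by exact_mod_cast hn
  have hn0 : (0 : ℝ) < n := lt_of_lt_of_le (lt_trans (by positivity) hN) hNn
  refine (fdrSU_le_add h (by exact_mod_cast hn0) hα hδ hδ' hd hη hdη hε hδd hεη hL0 hL hLx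
    hLα hcard (by exact_mod_cast hK0) ((one_div_lt hε hK0).1 hK).le).trans ?_
  have : ((K : ℝ) + 1) * (1 / (n * ε ^ 2)) ≤ e / 2 := by
    rw [div_lt_iff₀ (by positivity)] at hN
    rw [mul_one_div, mul_comm (n : ℝ), ← div_div, div_le_iff₀ hn0]
    nlinarith
  linarith

end UpperBound

/-! ### The Dirac-uniform configuration. -/

section DiracUniform

variable {n : ℕ}

/-- The law of a p-value in the Dirac-uniform configuration: uniform on `[0,1]` for a true null,
zero for a false one. -/
noncomputable def diracUniformMarginal (I₀ : Finset (Fin n)) (i : Fin n) : Measure ℝ :=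
  if i ∈ I₀ then volume.restrict (Set.Icc 0 1) else Measure.dirac 0

/-- The Dirac-uniform configuration with independent p-values. -/
noncomputable def diracUniform (I₀ : Finset (Fin n)) : Measure (Fin n → ℝ) :=
  Measure.pi (diracUniformMarginal I₀)

instance (I₀ : Finset (Fin n)) (i : Fin n) : IsProbabilityMeasure (diracUniformMarginal I₀ i) := by
  unfold diracUniformMarginal
  split_ifs
  · exact ⟨by simp⟩
  · infer_instance

instance (I₀ : Finset (Fin n)) : IsProbabilityMeasure (diracUniform I₀) := by
  unfold diracUniform
  infer_instance

lemma diracUniform_real_le {I₀ : Finset (Fin n)} {i : Fin n} (hi : i ∈ I₀) {x : ℝ}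
    (hx : x ∈ Set.Icc (0 : ℝ) 1) : (diracUniform I₀).real {p | p i ≤ x} = x := by
  have h := (measurePreserving_eval (diracUniformMarginal I₀) i).measure_preimage
    (measurableSet_Iic (a := x)).nullMeasurableSet
  have hset : Set.Iic x ∩ Set.Icc (0 : ℝ) 1 = Set.Icc 0 x := by
    ext y
    simp only [Set.mem_inter_iff, Set.mem_Iic, Set.mem_Icc]
    exact ⟨fun h => ⟨h.2.1, h.1⟩, fun h => ⟨h.2, h.1, h.2.trans hx.2⟩⟩
  have hv : diracUniformMarginal I₀ i (Set.Iic x) = ENNReal.ofReal x := by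
    rw [diracUniformMarginal, if_pos hi, Measure.restrict_apply measurableSet_Iic, hset]
    simp
  rw [hv] at h
  unfold Measure.real diracUniform
  exact (congrArg ENNReal.toReal h).trans (ENNReal.toReal_ofReal hx.1)

lemma diracUniform_ae_eval (I₀ : Finset (Fin n)) {i : Fin n} {s : Set ℝ}
    (h : ∀ᵐ x ∂(diracUniformMarginal I₀ i), x ∈ s) : ∀ᵐ p ∂(diracUniform I₀), p i ∈ s :=
  (measurePreserving_eval (diracUniformMarginal I₀) i).quasiMeasurePreserving.ae h

lemma diracUniform_ae_false (I₀ : Finset (Fin n)) :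
    ∀ᵐ p ∂(diracUniform I₀), ∀ i ∉ I₀, p i = 0 := by
  refine ae_all_iff.2 fun i => ?_
  by_cases hi : i ∈ I₀
  · exact ae_of_all _ fun p h => absurd hi h
  · have : ∀ᵐ x ∂(diracUniformMarginal I₀ i), x ∈ ({0} : Set ℝ) := by
      rw [diracUniformMarginal, if_neg hi, ae_dirac_eq]
      simp
    filter_upwards [diracUniform_ae_eval I₀ this] with p hp _ using hp

lemma isBIA_diracUniform (I₀ : Finset (Fin n)) : IsBIA I₀ (diracUniform I₀) := by
  have hind : iIndepFun (fun (i : Fin n) (p : Fin n → ℝ) => p i) (diracUniform I₀) :=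
    iIndepFun_pi (X := fun _ => id) fun _ => aemeasurable_id
  refine ⟨inferInstance, ae_all_iff.2 fun i => diracUniform_ae_eval I₀ ?_, ?_,
    hind.precomp Subtype.val_injective, fun i hi x hx => (diracUniform_real_le hi hx).le⟩
  · by_cases hi : i ∈ I₀
    · rw [diracUniformMarginal, if_pos hi]
      exact ae_restrict_mem measurableSet_Icc
    · rw [diracUniformMarginal, if_neg hi, ae_dirac_eq]
      simp
  · have h := hind.indepFun_finset I₀ I₀ᶜ disjoint_compl_right (fun i => measurable_pi_apply i)
    let G : ((I₀ᶜ : Finset (Fin n)) → ℝ) → ({i // i ∉ I₀} → ℝ) := fun z j =>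
      z ⟨j, Finset.mem_compl.2 j.2⟩
    have hG : Measurable G := measurable_pi_lambda _ fun j => measurable_pi_apply _
    exact h.comp measurable_id hG

variable {α δ : ℝ}

lemma fdrSU_diracUniform_eq (I₀ : Finset (Fin n)) (hα : 0 < α) (hδ : 0 ≤ δ) (hδ' : δ < 1 - α) :
    fdrSU (critVal α δ n) I₀ (diracUniform I₀) = (α * I₀.card + δ *
      ∫ p, (numFalseRej I₀ p (tauSU (critVal α δ n) p) : ℝ) ∂(diracUniform I₀)) / (n + 1) :=
  fdrSU_eq_of_uniform (isBIA_diracUniform I₀) hα hδ hδ' fun _ hi _ hx => diracUniform_real_le hi hx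

/-- The concave function `V / (V + m)` lies below its tangent at `w`; integrated at `w = E[V]`, this
is Jensen's inequality. -/
lemma div_add_le_tangent {V w m : ℝ} (hV : 0 ≤ V) (hw : 0 ≤ w) (hm : 0 < m) :
    V / (V + m) ≤ w / (w + m) + m / (w + m) ^ 2 * (V - w) := by
  have h : w / (w + m) + m / (w + m) ^ 2 * (V - w) - V / (V + m) =
      m * (V - w) ^ 2 / ((V + m) * (w + m) ^ 2) := by
    field_simp
    ring
  have : 0 ≤ m * (V - w) ^ 2 / ((V + m) * (w + m) ^ 2) := by positivity
  linarith

/-- Zero p-values are always counted, so almost surely `R = V + (n - n₀)`, and Jensen applies. -/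
lemma fdrSU_diracUniform_le {I₀ : Finset (Fin n)} (hI : I₀.card < n) {a : Fin n → ℝ}
    (ha : ∀ k, 0 < a k) {w : ℝ}
    (hw : w = ∫ p, (numFalseRej I₀ p (tauSU a p) : ℝ) ∂(diracUniform I₀)) :
    fdrSU a I₀ (diracUniform I₀) ≤ w / (w + (n - I₀.card)) := by
  have hm : (0 : ℝ) < n - I₀.card := sub_pos.2 (by exact_mod_cast hI)
  set m : ℝ := n - I₀.card with hm'
  have hw0 : 0 ≤ w := hw ▸ integral_nonneg fun p => by positivity
  have hV := integrable_numFalseRej (P := diracUniform I₀) I₀ (measurable_tauSU ha)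
  have hR : ∀ᵐ p ∂(diracUniform I₀),
      (numFalseRej I₀ p (tauSU a p) : ℝ) / (numRej p (tauSU a p) : ℝ) ≤
        w / (w + m) + m / (w + m) ^ 2 * (numFalseRej I₀ p (tauSU a p) - w) := by
    filter_upwards [diracUniform_ae_false I₀] with p hp
    have h1 := numRej_eq_add I₀ p (tauSU a p)
    have h2 : (I₀ᶜ.filter fun i => p i ≤ tauSU a p) = I₀ᶜ := by
      refine Finset.filter_true_of_mem fun i hi => ?_
      rw [hp i (Finset.mem_compl.1 hi)]
      exact tauSU_nonneg ha
    have h3 : I₀.card + I₀ᶜ.card = n := by simp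
    have h3' : (I₀.card : ℝ) + I₀ᶜ.card = n := by exact_mod_cast h3
    have h4 : (numRej p (tauSU a p) : ℝ) = numFalseRej I₀ p (tauSU a p) + m := by
      rw [h1, h2, hm', ← h3']
      push_cast
      ring
    rw [h4]
    exact div_add_le_tangent (by positivity) hw0 hm
  have hint' : Integrable (fun p =>
      m / (w + m) ^ 2 * (numFalseRej I₀ p (tauSU a p) - w)) (diracUniform I₀) :=
    (hV.sub (integrable_const _)).const_mul _
  have hint : Integrable (fun p => w / (w + m) +
      m / (w + m) ^ 2 * (numFalseRej I₀ p (tauSU a p) - w)) (diracUniform I₀) :=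
    (integrable_const _).add hint'
  calc fdrSU a I₀ (diracUniform I₀) ≤ ∫ p, w / (w + m) +
      m / (w + m) ^ 2 * (numFalseRej I₀ p (tauSU a p) - w) ∂(diracUniform I₀) :=
        integral_mono_of_nonneg (ae_of_all _ fun p => by positivity) hint hR
    _ = w / (w + m) := by
        rw [integral_add (integrable_const _) hint',
          integral_const_mul, integral_sub hV (integrable_const _), ← hw]
        simp

end DiracUniform

/-! ### The quadratic equation for the limiting threshold. -/

section Root

variable {α c d : ℝ}

/-- The discriminant of the quadratic equation for `xRoot`. -/
noncomputable def xDisc (α c d : ℝ) : ℝ :=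
  (c * α + d * (1 - c) - 1) ^ 2 - 4 * (1 - c) * c * α * d

lemma xDisc_pos (hc : 0 < c) (hd : 0 < d) (hd' : d < 1 - α) : 0 < xDisc α c d := by
  -- For `q(y) = (α + d y)(1 - c + c y) - y` the discriminant is `q'(1)² - 4 d c q(1)`, and `q(1) =
  -- α + d - 1` is negative.
  have : xDisc α c d = (2 * d * c - (1 - c * α - d * (1 - c))) ^ 2 +
      4 * (d * c) * (1 - α - d) := by unfold xDisc; ring
  rw [this]
  have : 0 < 4 * (d * c) * (1 - α - d) := by
    have := mul_pos hd hc
    have : 0 < 1 - α - d := by linarith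
    positivity
  positivity

lemma two_mul_xRoot (hc : 0 < c) (hd : 0 < d) :
    2 * c * d * xRoot α c d = 1 - c * α - d * (1 - c) - √(xDisc α c d) := by
  unfold xRoot xDisc
  field_simp

/-- Factorization of the quadratic polynomial with smaller root `xRoot`. -/
lemma xRoot_factor (hc : 0 < c) (hd : 0 < d) (hd' : d < 1 - α) (y : ℝ) :
    (α + d * y) * (1 - c + c * y) - y =
      (xRoot α c d - y) * (√(xDisc α c d) + d * c * (xRoot α c d - y)) := by
  have h := two_mul_xRoot (α := α) hc hd
  have hs := Real.sq_sqrt (xDisc_pos (α := α) hc hd hd').le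
  have hs' : √(xDisc α c d) = 1 - c * α - d * (1 - c) - 2 * c * d * xRoot α c d := by linarith
  have hq : 4 * (c * d) * ((α + d * xRoot α c d) * (1 - c + c * xRoot α c d) - xRoot α c d) = 0 := by
    rw [hs'] at hs
    unfold xDisc at hs
    linear_combination hs
  have hq' := (mul_eq_zero.1 hq).resolve_left (by positivity)
  rw [hs']
  linear_combination hq'

lemma xRoot_eq (hc : 0 < c) (hd : 0 < d) (hd' : d < 1 - α) :
    (α + d * xRoot α c d) * (1 - c + c * xRoot α c d) = xRoot α c d := by
  have := xRoot_factor hc hd hd' (xRoot α c d)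
  linarith [sub_self (xRoot α c d), this.trans (by ring : _ = (0 : ℝ))]

lemma xRoot_pos (hα : 0 < α) (hc : 0 < c) (hc1 : c < 1) (hd : 0 < d) (hd' : d < 1 - α) :
    0 < xRoot α c d := by
  have h := two_mul_xRoot (α := α) hc hd
  have hb : 0 < 1 - c * α - d * (1 - c) := by nlinarith
  have hs : √(xDisc α c d) < 1 - c * α - d * (1 - c) := by
    rw [Real.sqrt_lt' hb]
    have : 0 < 4 * (1 - c) * c * α * d := by
      have : 0 < 1 - c := by linarith
      positivity
    unfold xDisc
    nlinarith
  have : 0 < 2 * c * d * xRoot α c d := by linarith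
  exact (mul_pos_iff_of_pos_left (by positivity)).1 this

lemma xRoot_lt_one (hc : 0 < c) (hd : 0 < d) (hd' : d < 1 - α) :
    xRoot α c d < 1 := by
  have h := two_mul_xRoot (α := α) hc hd
  have hs : 1 - c * α - d * (1 - c) - 2 * c * d < √(xDisc α c d) := by
    refine Real.lt_sqrt_of_sq_lt ?_
    have : 0 < d * c * (1 - α - d) := mul_pos (mul_pos hd hc) (by linarith)
    unfold xDisc
    nlinarith
  have hcd : 0 < 2 * c * d := by positivity
  have : 2 * c * d * xRoot α c d < 2 * c * d * 1 := by linarith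
  exact lt_of_mul_lt_mul_left this hcd.le

lemma xRoot_limit_eq (hα : 0 < α) (hc : 0 < c) (hc1 : c < 1) (hd : 0 < d) (hd' : d < 1 - α) :
    c * xRoot α c d / (1 - c + c * xRoot α c d) = c * (α + d * xRoot α c d) := by
  have hx := xRoot_pos hα hc hc1 hd hd'
  have : 0 < 1 - c + c * xRoot α c d := by
    have := mul_pos hc hx
    linarith
  rw [div_eq_iff this.ne', mul_assoc, xRoot_eq hc hd hd']

lemma xRoot_limit_mul (hc : 0 < c) (hd : 0 < d) (hd' : d < 1 - α) :
    c * (α + d * xRoot α c d) * (1 - xRoot α c d) = α - (1 - d) * xRoot α c d := by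
  linear_combination -(xRoot_eq (α := α) hc hd hd')

lemma xRoot_limit_lt (hα : 0 < α) (hc : 0 < c) (hc1 : c < 1) (hd : 0 < d) (hd' : d < 1 - α) :
    c * (α + d * xRoot α c d) < α := by
  have hx := xRoot_pos hα hc hc1 hd hd'
  have hx1 := xRoot_lt_one (α := α) hc hd hd'
  have h := xRoot_limit_mul (α := α) hc hd hd'
  refine lt_of_mul_lt_mul_right (a := 1 - xRoot α c d) ?_ (by linarith)
  rw [h]
  nlinarith

end Root

/-! ### Lower bound from the Dirac-uniform configuration. -/

section LowerBound

variable {n : ℕ} {α δ : ℝ}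

/-- Eliminating `F` gives `c q(y) ≤ 3 ε` for the quadratic `q` factored in `xRoot_factor`. For `y`
below the root, `q(y) ≥ (x - y) √(xDisc α c d)`, so `y` cannot be much smaller than `x`. -/
lemma xRoot_limit_sub_le {c d ε y F : ℝ} (hα : 0 < α) (hc : 0 < c) (hc1 : c < 1) (hd : 0 < d)
    (hd' : d < 1 - α) (hε : 0 ≤ ε) (hy0 : 0 ≤ c * y) (hy1 : c * y ≤ c)
    (hF : c * (α + d * y) - 3 * ε ≤ F) (hF' : F * (1 - c + c * y) ≤ c * y) :
    c * (α + d * xRoot α c d) - (3 / √(xDisc α c d) + 3) * ε ≤ F := by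
  have hs : 0 < √(xDisc α c d) := Real.sqrt_pos.2 (xDisc_pos hc hd hd')
  have hfac := xRoot_factor (α := α) hc hd hd' y
  generalize xRoot α c d = x at *
  generalize √(xDisc α c d) = s at *
  have hquad : (c * (α + d * y) - 3 * ε) * (1 - c + c * y) ≤ c * y :=
    (mul_le_mul_of_nonneg_right hF (by linarith)).trans hF'
  have h0 : 3 * ε * (1 - c + c * y) ≤ 3 * ε * 1 :=
    mul_le_mul_of_nonneg_left (by linarith) (by linarith)
  have h1 : c * ((x - y) * (s + d * c * (x - y))) ≤ 3 * ε := by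
    rw [← hfac]
    linarith
  have h2 : d * (c * (x - y)) ≤ 3 / s * ε := by
    rcases le_total x y with h | h
    · have : d * (c * (x - y)) ≤ 0 :=
        mul_nonpos_of_nonneg_of_nonpos hd.le
          (mul_nonpos_of_nonneg_of_nonpos hc.le (by linarith))
      exact this.trans (by positivity)
    · have hxy : 0 ≤ c * (x - y) := mul_nonneg hc.le (by linarith)
      have h3 : c * (x - y) * s ≤ 3 * ε := by
        have : 0 ≤ d * (c * (x - y)) * (c * (x - y)) := by positivity
        linarith
      have h4 : c * (x - y) ≤ 3 / s * ε := by
        rw [div_mul_eq_mul_div, le_div_iff₀ hs]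
        exact h3
      exact (mul_le_of_le_one_left hxy (by linarith)).trans h4
  linarith

lemma xRoot_limit_sub_le_of_eq {c d ε F w m N : ℝ} (hN : 0 < N) (hα : 0 < α)
    (hδd : |δ - d| ≤ ε) (hδ : 0 ≤ δ) (hc : 0 < c) (hc1 : c < 1) (hd : 0 < d) (hd' : d < 1 - α)
    (hNε : 1 / N ≤ ε) (hm : m ≤ c * N) (hm' : c * N - 1 ≤ m) (hmN : m < N) (hw0 : 0 ≤ w)
    (hwm : w ≤ m) (hF : F = (α * m + δ * w) / (N + 1)) (hF' : F ≤ w / (w + (N - m))) :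
    c * (α + d * xRoot α c d) - (3 / √(xDisc α c d) + 3) * ε ≤ F := by
  have hε : 0 ≤ ε := (abs_nonneg _).trans hδd
  have hδd' := (abs_le.1 hδd).1
  obtain ⟨y, rfl⟩ : ∃ y, w = c * y * N := ⟨w / (c * N), by field_simp⟩
  have hy0 : 0 ≤ c * y := nonneg_of_mul_nonneg_left hw0 hN
  have hy1 : c * y ≤ c := le_of_mul_le_mul_right (hwm.trans hm) hN
  have hNε' : 1 ≤ ε * N := (div_le_iff₀ hN).1 hNε
  have hF0 : 0 ≤ F := by
    have : 0 ≤ m := hw0.trans hwm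
    rw [hF]
    positivity
  refine xRoot_limit_sub_le hα hc hc1 hd hd' hε hy0 hy1 ?_ ?_
  -- Three errors of size `ε`: rounding `m` down from `c * N`, replacing `δ` by `d`, and dividing by
  -- `N + 1` instead of `N`.
  · rw [hF, le_div_iff₀ (by positivity)]
    have h1 : α * (c * N - ε * N) ≤ α * m := mul_le_mul_of_nonneg_left (by linarith) hα.le
    have h2 : (d - ε) * (c * y * N) ≤ δ * (c * y * N) :=
      mul_le_mul_of_nonneg_right (by linarith) hw0
    have h3 : c * (α + d * y) ≤ 1 := by
      have h31 : c * α ≤ α := mul_le_of_le_one_left hα.le hc1.le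
      have h32 : d * (c * y) ≤ d := mul_le_of_le_one_right hd.le (by linarith)
      linarith
    have h4 : α * (ε * N) ≤ ε * N := mul_le_of_le_one_left (by positivity) (by linarith)
    have h5 : ε * (c * y * N) ≤ ε * N := mul_le_mul_of_nonneg_left (by linarith) hε
    linarith
  · rw [le_div_iff₀ (by linarith)] at hF'
    have h2 : F * (1 - c + c * y) * N ≤ c * y * N := by
      rw [mul_assoc]
      exact le_trans (mul_le_mul_of_nonneg_left (by linarith) hF0) hF'
    exact le_of_mul_le_mul_right h2 hN

lemma le_fdrSU_diracUniform {c d ε : ℝ} {I₀ : Finset (Fin n)} (hn : 0 < n) (hα : 0 < α)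
    (hδ : 0 ≤ δ) (hδ' : δ < 1 - α) (hc : 0 < c) (hc1 : c < 1) (hd : 0 < d) (hd' : d < 1 - α)
    (hδd : |δ - d| ≤ ε) (hnε : 1 / (n : ℝ) ≤ ε) (hI : (I₀.card : ℝ) ≤ c * n)
    (hI' : c * n - 1 ≤ I₀.card) :
    c * (α + d * xRoot α c d) - (3 / √(xDisc α c d) + 3) * ε ≤
      fdrSU (critVal α δ n) I₀ (diracUniform I₀) := by
  have hn' : (0 : ℝ) < n := by exact_mod_cast hn
  have hIn : (I₀.card : ℝ) < n := hI.trans_lt (mul_lt_of_lt_one_left hn' hc1)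
  have hp := critVal_pos (n := n) hα hδ hδ'
  refine xRoot_limit_sub_le_of_eq hn' hα hδd hδ hc hc1 hd hd' hnε hI hI' hIn
    (integral_nonneg fun p => by positivity) ?_ (fdrSU_diracUniform_eq I₀ hα hδ hδ')
    (fdrSU_diracUniform_le (by exact_mod_cast hIn) hp rfl)
  have : ∫ p, (numFalseRej I₀ p (tauSU (critVal α δ n) p) : ℝ) ∂(diracUniform I₀) ≤
      ∫ _, (I₀.card : ℝ) ∂(diracUniform I₀) :=
    integral_mono (integrable_numFalseRej I₀ (measurable_tauSU hp)) (integrable_const _)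
      fun p => Nat.cast_le.2 (numFalseRej_le_card I₀ p _)
  simpa using this

lemma exists_card_eq_floor {c : ℝ} (hc : 0 ≤ c) (hc1 : c ≤ 1) (n : ℕ) :
    ∃ I₀ : Finset (Fin n), (I₀.card : ℝ) ≤ c * n ∧ c * n - 1 < I₀.card := by
  have h : ⌊c * n⌋₊ ≤ (Finset.univ : Finset (Fin n)).card := by
    rw [Finset.card_univ, Fintype.card_fin]
    refine Nat.floor_le_of_le ?_
    have : (0 : ℝ) ≤ n := n.cast_nonneg
    nlinarith
  obtain ⟨I₀, -, hI⟩ := Finset.exists_subset_card_eq h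
  exact ⟨I₀, hI ▸ Nat.floor_le (by positivity), hI ▸ Nat.sub_one_lt_floor _⟩

end LowerBound

/-! ### Limits of the worst-case FDR. -/

section WorstCase

variable {α : ℝ} {δ : ℕ → ℝ}

lemma bddAbove_worstFDR (α δ : ℝ) (n : ℕ) :
    BddAbove {r : ℝ | ∃ (I₀ : Finset (Fin n)) (P : Measure (Fin n → ℝ)),
      I₀.Nonempty ∧ IsBIA I₀ P ∧ r = fdrSU (critVal α δ n) I₀ P} := by
  refine ⟨1, ?_⟩
  rintro r ⟨I₀, P, -, hP, rfl⟩
  have := hP.isProb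
  exact fdrSU_le_one _ _

lemma bddAbove_worstFDRBounded (α δ c : ℝ) (n : ℕ) :
    BddAbove {r : ℝ | ∃ (I₀ : Finset (Fin n)) (P : Measure (Fin n → ℝ)),
      I₀.Nonempty ∧ (I₀.card : ℝ) ≤ c * n ∧ IsBIA I₀ P ∧
        r = fdrSU (critVal α δ n) I₀ P} := by
  refine ⟨1, ?_⟩
  rintro r ⟨I₀, P, -, -, hP, rfl⟩
  have := hP.isProb
  exact fdrSU_le_one _ _

lemma tendsto_worstFDR (hα0 : 0 < α) (hδ : ∀ n, 1 ≤ n → 0 ≤ δ n ∧ δ n < 1 - α)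
    (hlim : limsup δ atTop < 1 - α) :
    Tendsto (fun n => worstFDR α (δ n) n) atTop (𝓝 α) := by
  have hbdd : IsBoundedUnder (· ≤ ·) atTop δ :=
    isBoundedUnder_of_eventually_le (a := 1 - α)
      ((eventually_ge_atTop 1).mono fun n hn => (hδ n hn).2.le)
  obtain ⟨b, hb, hb'⟩ := exists_between hlim
  have hδb := eventually_lt_of_limsup_lt hb hbdd
  refine tendsto_order.2 ⟨fun u hu => ?_, fun u hu => ?_⟩
  · have hlow : Tendsto (fun n : ℕ => α * ((n : ℝ) / (n + 1))) atTop (𝓝 (α * 1)) :=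
      (tendsto_natCast_div_add_atTop (1 : ℝ)).const_mul α
    rw [mul_one] at hlow
    filter_upwards [hlow.eventually_const_lt hu, eventually_ge_atTop 1] with n hn hn1
    refine hn.trans_le ?_
    obtain ⟨h0, h1⟩ := hδ n hn1
    have : NeZero n := ⟨by omega⟩
    refine le_trans ?_ (le_csSup (bddAbove_worstFDR α (δ n) n)
      ⟨Finset.univ, diracUniform Finset.univ, Finset.univ_nonempty, isBIA_diracUniform _, rfl⟩)
    rw [fdrSU_diracUniform_eq _ hα0 h0 h1, Finset.card_univ, Fintype.card_fin,
      ← mul_div_assoc]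
    gcongr
    exact le_add_of_nonneg_right (mul_nonneg h0 (integral_nonneg fun p => by positivity))
  · obtain ⟨ε, hε, N, hN⟩ := exists_forall_fdrSU_le (α := α) (η := 1 - α - b)
      (e := (u - α) / 2) hα0 (by linarith) (by linarith)
    filter_upwards [hδb, eventually_ge_atTop N, eventually_ge_atTop 1] with n hn hnN hn1
    obtain ⟨h0, h1⟩ := hδ n hn1
    refine lt_of_le_of_lt (b := α + (u - α) / 2) (Real.sSup_le ?_ (by linarith)) (by linarith)
    rintro r ⟨I₀, P, -, hP, rfl⟩
    -- Degenerate parameters: `d` is `δ n` itself, `x = 0`, `L = α`, `c₀ = 1`.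
    refine hN n hnN (δ n) (δ n) 0 α 1 h0 h1 h0 (by linarith) (by simpa using hε.le) hα0.le
      (by ring) (by ring) le_rfl I₀ P hP ?_
    rw [one_mul]
    exact_mod_cast (Finset.card_le_univ I₀).trans_eq (Fintype.card_fin n)

lemma tendsto_worstFDRBounded (hα0 : 0 < α) (hδ : ∀ n, 1 ≤ n → 0 ≤ δ n ∧ δ n < 1 - α)
    {c d : ℝ} (hd : 0 < d) (hd' : d < 1 - α) (hlim : Tendsto δ atTop (𝓝 d)) (hc : 0 < c)
    (hc1 : c < 1) :
    Tendsto (fun n => worstFDRBounded α (δ n) c n) atTop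
      (𝓝 (c * (α + d * xRoot α c d))) := by
  have hx := xRoot_pos hα0 hc hc1 hd hd'
  have hclose : ∀ ε > 0, ∀ᶠ n in atTop, |δ n - d| ≤ ε := fun ε hε =>
    (Metric.tendsto_nhds.1 hlim ε hε).mono fun n hn => hn.le
  set L := c * (α + d * xRoot α c d) with hL
  have hL0 : 0 ≤ L := by positivity
  refine tendsto_order.2 ⟨fun u hu => ?_, fun u hu => ?_⟩
  · obtain ⟨ε, hε, hεu⟩ : ∃ ε > 0, (3 / √(xDisc α c d) + 3) * ε < L - u := by
      have hk : 0 < 3 / √(xDisc α c d) + 3 := by positivity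
      refine ⟨(L - u) / 2 / (3 / √(xDisc α c d) + 3), by
        have : 0 < L - u := by linarith
        positivity, ?_⟩
      rw [mul_div_cancel₀ _ hk.ne']
      linarith
    filter_upwards [hclose ε hε, eventually_ge_atTop 1,
      (tendsto_natCast_atTop_atTop (R := ℝ)).eventually_ge_atTop (1 / ε),
      (tendsto_natCast_atTop_atTop (R := ℝ)).eventually_ge_atTop (1 / c)] with n hn hn1 hnε hnc
    obtain ⟨h0, h1⟩ := hδ n hn1
    have hn' : (0 : ℝ) < n := by exact_mod_cast hn1
    obtain ⟨I₀, hI, hI'⟩ := exists_card_eq_floor hc.le hc1.le n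
    -- The requirement `n ≥ 1 / c` makes `c * n - 1` nonnegative, and the cardinality exceeds it.
    have hne : I₀.Nonempty := by
      have : (0 : ℝ) < I₀.card := by
        have := (div_le_iff₀ hc).1 hnc
        linarith
      exact Finset.card_pos.1 (by exact_mod_cast this)
    have h := le_fdrSU_diracUniform hn1 hα0 h0 h1 hc hc1 hd hd' hn
      ((one_div_le hε hn').1 hnε) hI hI'.le
    refine lt_of_lt_of_le ?_ (le_csSup (bddAbove_worstFDRBounded α (δ n) c n)
      ⟨I₀, diracUniform I₀, hne, hI, isBIA_diracUniform _, rfl⟩)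
    linarith
  · obtain ⟨ε, hε, N, hN⟩ := exists_forall_fdrSU_le (α := α) (η := 1 - α - d)
      (e := (u - L) / 2) hα0 (by linarith) (by linarith)
    filter_upwards [hclose ε hε, eventually_ge_atTop N, eventually_ge_atTop 1] with n hn hnN hn1
    obtain ⟨h0, h1⟩ := hδ n hn1
    refine lt_of_le_of_lt (b := L + (u - L) / 2) (Real.sSup_le ?_ (by linarith)) (by linarith)
    rintro r ⟨I₀, P, -, hI, hP, rfl⟩
    exact hN n hnN (δ n) d _ L c h0 h1 hd.le (by linarith) hn hL0 hL
      (xRoot_limit_mul hc hd hd') (xRoot_limit_lt hα0 hc hc1 hd hd').le I₀ P hP hI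

end WorstCase

end StepUp

theorem mainTheorem5 (α : ℝ) (hα0 : 0 < α) (hα1 : α < 1) (δ : ℕ → ℝ)
    (hδ : ∀ n, 1 ≤ n → 0 ≤ δ n ∧ δ n < 1 - α) :
    (limsup δ atTop < 1 - α →
      limsup (fun n => StepUp.worstFDR α (δ n) n) atTop = α) ∧
    (∀ d c : ℝ, 0 < d → d < 1 - α → Tendsto δ atTop (𝓝 d) → α < c → c < 1 →
      limsup (fun n => StepUp.worstFDRBounded α (δ n) c n) atTop
          = c * StepUp.xRoot α c d / (1 - c + c * StepUp.xRoot α c d) ∧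
        c * StepUp.xRoot α c d / (1 - c + c * StepUp.xRoot α c d) < α) := by
  refine ⟨fun h => (StepUp.tendsto_worstFDR hα0 hδ h).limsup_eq, fun d c hd hd' hlim hc hc1 => ?_⟩
  have hc0 := hα0.trans hc
  rw [StepUp.xRoot_limit_eq hα0 hc0 hc1 hd hd']
  exact ⟨(StepUp.tendsto_worstFDRBounded hα0 hδ hd hd' hlim hc0 hc1).limsup_eq,
    StepUp.xRoot_limit_lt hα0 hc0 hc1 hd hd'⟩
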